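/- Let $G=(V,E)$ be a finite directed graph with real capacities $C_{ij}$ and linear costs $f_{ij}\in\mathbb R$ on the edges, three distinct source nodes, numbered $S=\{1,2,3\}$, with storage costs $d_1,d_2,d_3\ge 0$, a nonempty set $T\subseteq V$ of terminals, and an original source of entropy $h\ge 0$. Let $G^*=(V^*,E^*)$ arise from $G$ by adding a node $s^*$ and edges $(s^*,i)$, $i\in S$, of infinite capacity; write $c^*$ for the capacities of $G^*$. A *feasible flow* consists of reals $x^{(t)}_{ij},z_{ij}$ ($t\in T$, $(i,j)\in E^*$) with $0\le x^{(t)}_{ij}\le z_{ij}\le c^*_{ij}$ and $$\sum_{j:(i,j)\in E^*}x^{(t)}_{ij}-\sum_{j:(j,i)\in E^*}x^{(t)}_{ji}=\sigma^{(t)}_i\qquad(i\in V^*,\ t\in T),$$ where $\sigma^{(t)}_{s^*}=h$, $\sigma^{(t)}_t=-h$ and $\sigma^{(t)}_i=0$ otherwise. Assume that a feasible flow exists. Let $\mathcal A$ be the set of the $7$ nonempty atoms of the field generated by $\tilde X_1,\tilde X_2,\tilde X_3$, and put $\tilde X_W=\bigcup_{i\in W}\tilde X_i$. For $\mu:\mathcal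 A\to\mathbb R$ write $H(X_i)=\sum_{A\subseteq\tilde X_i}\mu(A)$, $H(X_U\mid X_{S\setminus U})=\sum_{A\not\subseteq\tilde X_{S\setminus U}}\mu(A)$ and $I(X_i;X_j\mid X_K)=\sum_{A\subseteq\tilde X_i,\,A\subseteq\tilde X_j,\,A\not\subseteq\tilde X_K}\mu(A)$. Consider the constraints (*) on $x,z,\mu$ and rates $R^{(t)}_i$ ($t\in T$, $i\in S$): $(x,z)$ is a feasible flow; $x^{(t)}_{s^*i}\ge R^{(t)}_i$; $\sum_{i\in U}R^{(t)}_i\ge H(X_U\mid X_{S\setminus U})$ for all $U\subseteq S$; $z_{s^*i}=H(X_i)$; and $\sum_{A\in\mathcal A}\mu(A)=h$. * CODED-MIN-COST: minimize $\sum_{(i,j)\in E}f_{ij}z_{ij}+\sum_{i\in S}d_iz_{s^*i}$ over feasible flows. * SUBSET-MIN-COST: minimize $\sum_{(i,j)\in E}f_{ij}z_{ij}+\sum_{A\in\mathcal A}\bigl(\sum_{i:A\subseteq\tilde X_i}d_i\bigr)\mu(A)$ subject to (*) and $\mu(A)\ge 0$ for all $A\in\mathcal A$. * ATOM-CODED-MIN-COST: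 minimize $\sum_{(i,j)\in E}f_{ij}z_{ij}+\sum_{i\in S}d_iz_{s^*i}$ subject to (*) and the elemental inequalities $H(X_i\mid X_{S\setminus\{i\}})\ge 0$ for all $i$ and $I(X_i;X_j\mid X_K)\ge 0$ for all $i\ne j$ and $K\subseteq S\setminus\{i,j\}$. Then all three problems attain their optimal values, and those of CODED-MIN-COST and ATOM-CODED-MIN-COST are equal. Let $f_{\rm subset}$ and $f_{\rm coded}$ be the optimal values of SUBSET-MIN-COST and CODED-MIN-COST, and let $b^*=\mu(\tilde X_1\cap\tilde X_2\cap\tilde X_3)$ in any optimal solution of ATOM-CODED-MIN-COST. If $b^*\ge 0$, then $f_{\rm subset}=f_{\rm coded}$. If $b^*<0$, then $$f_{\rm subset}-f_{\rm coded}\ \le\ \bigl(\min_{i\in S}d_i\bigr)\,|b^*|\ \le\ \bigl(\min_{i\in S}d_i\bigr)\,\frac h2 .$$ Moreover the bound is attained: there is a network with nine nodes $1,\dots,9$, source nodes $1,2,3$, terminals $6,7,8,9$, unit capacities and unit costs on all edges, $d_1=d_2=2$, $d_3=1$ and $h=2$, for which $f_{\rm subset}=17$ and $f_{\rm coded}=16$,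 and every optimal solution of ATOM-CODED-MIN-COST has $b^*<0$ and $f_{\rm subset}-f_{\rm coded}=(\min_i d_i)|b^*|=(\min_i d_i)h/2$. -/

import Mathlib

/-- A directed network `G = (V, E, C)` with `n` numbered source nodes, a nonempty set of terminals,
linear edge costs `f`, linear storage costs `d` and an original source of entropy `h`.
The values of `cap` and `f` matter only on pairs that are edges. -/
structure Network (V : Type*) (n : ℕ) where
  edges : Finset (V × V)
  cap : V → V → ℝ
  f : V → V → ℝ
  src : Fin n ↪ V
  terminals : Finset V
  terminals_nonempty : terminals.Nonempty
  d : Fin n → ℝ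
  d_nonneg : ∀ i, 0 ≤ d i
  h : ℝ
  h_nonneg : 0 ≤ h

/-- A nonempty atom of the field generated by `X̃₁, …, X̃ₙ`, encoded by the nonempty set of those
indices `i` for which the atom is contained in `X̃ᵢ` (it is contained in the complement of the
other `X̃ᵢ`). -/
abbrev Atom (n : ℕ) : Type := {A : Finset (Fin n) // A.Nonempty}

namespace Atom

variable {n : ℕ}

/-- The atom is contained in `X̃_W = ⋃_{i ∈ W} X̃ᵢ`. -/
abbrev Sub (A : Atom n) (W : Finset (Fin n)) : Prop := ∃ i ∈ W, i ∈ A.1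

/-- The atom `X̃₁ ∩ X̃₂ ∩ X̃₃`. -/
def triple : Atom 3 := ⟨Finset.univ, Finset.univ_nonempty⟩

end Atom

section Measure

variable {n : ℕ}

/-- `H(X_i)`, the sum of `μ(A)` over atoms `A ⊆ X̃ᵢ`. -/
def entropy (μ : Atom n → ℝ) (i : Fin n) : ℝ := ∑ A with A.Sub {i}, μ A

/-- `H(X_U | X_{S∖U})`, the sum of `μ(A)` over atoms `A ⊄ X̃_{S∖U}`. -/
def condEntropy (μ : Atom n → ℝ) (U : Finset (Fin n)) : ℝ := ∑ A with ¬ A.Sub Uᶜ, μ A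

/-- `I(X_i ; X_j | X_K)`, the sum of `μ(A)` over atoms `A ⊆ X̃ᵢ`, `A ⊆ X̃ⱼ`, `A ⊄ X̃_K`. -/
def condMutualInfo (μ : Atom n → ℝ) (i j : Fin n) (K : Finset (Fin n)) : ℝ :=
  ∑ A with A.Sub {i} ∧ A.Sub {j} ∧ ¬ A.Sub K, μ A

/-- The Slepian–Wolf region of the sources with atom measures `μ`. -/
def slepianWolf (μ : Atom n → ℝ) : Set (Fin n → ℝ) :=
  {R | ∀ U : Finset (Fin n), condEntropy μ U ≤ ∑ i ∈ U, R i}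

/-- The elemental (hence all Shannon type) inequalities. -/
def Elemental (μ : Atom n → ℝ) : Prop :=
  (∀ i, 0 ≤ condEntropy μ {i}) ∧
  ∀ i j, i ≠ j → ∀ K : Finset (Fin n), i ∉ K → j ∉ K → 0 ≤ condMutualInfo μ i j K

end Measure

/-- Flow variables on the augmented graph, whose vertex set is `Option V` with `none` the virtual
super node `s*`: `x t u v` is the flow for terminal `t` on the edge `(u, v)`, `z u v` the amount
of flow paid for on that edge. Only the values at terminals `t` and at edges `(u, v)` matter. -/
structure FlowVars (V : Type*) where
  x : V → Option V → Option V → ℝ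
  z : Option V → Option V → ℝ

/-- Flow variables, rates `R t i` from source `i` to terminal `t`, and atom measures `μ`. -/
structure AtomVars (V : Type*) (n : ℕ) extends FlowVars V where
  R : V → Fin n → ℝ
  μ : Atom n → ℝ

namespace Network

variable {V : Type*} [Fintype V] [DecidableEq V] {n : ℕ} (N : Network V n)

/-- Edges of the augmented graph `G*`: those of `G`, and `(s*, i)` for every source node `i`. -/
def augEdges : Finset (Option V × Option V) :=
  N.edges.image (fun e => (some e.1, some e.2)) ∪
    Finset.univ.image (fun i => (none, some (N.src i)))

/-- Capacities in `G*`; the virtual edges have infinite capacity. -/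
noncomputable def augCap : Option V → Option V → EReal
  | some u, some v => (N.cap u v : EReal)
  | _, _ => ⊤

/-- The net outflow `σ` prescribed at a vertex for terminal `t`. -/
def sigma (t : V) (v : Option V) : ℝ :=
  if v = none then N.h else if v = some t then -N.h else 0

/-- `0 ≤ x ≤ z ≤ c*` on all edges of `G*`, and flow balance at all vertices of `G*`. -/
def FlowFeasible (p : FlowVars V) : Prop :=
  (∀ t ∈ N.terminals, ∀ u v, (u, v) ∈ N.augEdges →
    0 ≤ p.x t u v ∧ p.x t u v ≤ p.z u v ∧ (p.z u v : EReal) ≤ N.augCap u v) ∧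
  ∀ t ∈ N.terminals, ∀ v,
    ∑ w with (v, w) ∈ N.augEdges, p.x t v w - ∑ w with (w, v) ∈ N.augEdges, p.x t w v = N.sigma t v

/-- Cost of the flow over the edges of `G`. -/
def edgeCost (p : FlowVars V) : ℝ := ∑ e ∈ N.edges, N.f e.1 e.2 * p.z (some e.1) (some e.2)

/-- Objective `∑ f z + ∑ dᵢ z_{s* i}`. -/
def codedCost (p : FlowVars V) : ℝ :=
  N.edgeCost p + ∑ i, N.d i * p.z none (some (N.src i))

/-- Objective `∑ f z + ∑_A (∑_{i : A ⊆ X̃ᵢ} dᵢ) μ(A)`. -/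
def subsetCost (p : AtomVars V n) : ℝ :=
  N.edgeCost p.toFlowVars + ∑ A : Atom n, (∑ i with A.Sub {i}, N.d i) * p.μ A

/-- The constraints shared by SUBSET-MIN-COST and ATOM-CODED-MIN-COST. -/
def AtomFeasible (p : AtomVars V n) : Prop :=
  N.FlowFeasible p.toFlowVars ∧
  (∀ t ∈ N.terminals, ∀ i, p.R t i ≤ p.x t none (some (N.src i))) ∧
  (∀ t ∈ N.terminals, p.R t ∈ slepianWolf p.μ) ∧
  (∀ i, p.z none (some (N.src i)) = entropy p.μ i) ∧
  N.h = ∑ A, p.μ A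

/-- Feasibility for SUBSET-MIN-COST. -/
def SubsetFeasible (p : AtomVars V n) : Prop := N.AtomFeasible p ∧ ∀ A, 0 ≤ p.μ A

/-- Feasibility for ATOM-CODED-MIN-COST. -/
def AtomCodedFeasible (p : AtomVars V n) : Prop := N.AtomFeasible p ∧ Elemental p.μ

/-- Optimal solutions of ATOM-CODED-MIN-COST. -/
def AtomCodedOptimal (p : AtomVars V n) : Prop :=
  N.AtomCodedFeasible p ∧
    ∀ q, N.AtomCodedFeasible q → N.codedCost p.toFlowVars ≤ N.codedCost q.toFlowVars

/-- `c` is the optimal value of CODED-MIN-COST (whose feasible points are the feasible flows). -/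
def IsCodedMinCost (c : ℝ) : Prop := IsLeast (N.codedCost '' {p | N.FlowFeasible p}) c

/-- `c` is the optimal value of SUBSET-MIN-COST. -/
def IsSubsetMinCost (c : ℝ) : Prop := IsLeast (N.subsetCost '' {p | N.SubsetFeasible p}) c

end Network

/-- The minimum of the storage costs of three sources. -/
def Network.minD {V : Type*} (N : Network V 3) : ℝ :=
  Finset.univ.inf' Finset.univ_nonempty N.d

/-! ### Signed measures on the seven atoms of three sources. -/

section AtomMeasure

/-! Write `c i`, `a i`, `b` for the masses of `single i`, `pairAvoiding i` and `triple`. For three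
sources the elemental inequalities say `c i ≥ 0`, `a i ≥ 0`, `a i + b ≥ 0` (`elemental_three`). So
only `b` can be negative, and since the total mass is `∑ c i + ∑ (a i + b) - 2 * b`, it is at least
`-h / 2`.

CODED and ATOM-CODED agree: given a flow, cap each storage amount at `h` and use the polymatroid `W
↦ min h (∑ i ∈ W, g i)` as joint entropy. Its Möbius inverse is a measure satisfying the elemental
inequalities. Taking the flows out of `s*` as rates, the Slepian–Wolf bound for `U` holds because
all rates add up to `h` and those outside `U` to at most the joint entropy there
(`FlowFeasible.exists_atomCodedFeasible`).

The two objectives agree on (*) by double counting, so SUBSET is ATOM-CODED with the extra condition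
`b ≥ 0`. If an optimal measure has `b ≥ 0`, the values coincide. If `b < 0`, move `b` onto the
single atom `pairAvoiding k`: only `H(X_k)` changes, growing by `|b|`, at cost `d k * |b|`
(`AtomCodedFeasible.exists_subsetFeasible`). Choose `k` of least storage cost. Optima exist by
compactness.

In the example (nodes counted from `0`) each terminal needs both of its incoming unit edges. This
forces the edge cost `11` and, for each source, a terminal receiving nothing from it, so all `c i`
vanish at feasible points of both atom problems. Unit storage everywhere then forces `b = -1`, while
nonnegative measures need one more unit of cost. -/

/-- The atom contained in `X̃ᵢ` only. -/
def Atom.single (i : Fin 3) : Atom 3 := ⟨{i}, Finset.singleton_nonempty i⟩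

/-- The atom contained in both `X̃ⱼ` with `j ≠ i`, but not in `X̃ᵢ`. -/
def Atom.pairAvoiding (i : Fin 3) : Atom 3 := ⟨{i}ᶜ, by fin_cases i <;> decide⟩

open Atom

theorem Atom.univ_three : (Finset.univ : Finset (Atom 3)) =
    {single 0, single 1, single 2, pairAvoiding 0, pairAvoiding 1, pairAvoiding 2, triple} := by
  decide

theorem Atom.sum_three (g : Atom 3 → ℝ) : ∑ A, g A =
    g (single 0) + g (single 1) + g (single 2) +
      (g (pairAvoiding 0) + g (pairAvoiding 1) + g (pairAvoiding 2)) + g triple := by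
  rw [Atom.univ_three]
  iterate 6 rw [Finset.sum_insert (by decide)]
  rw [Finset.sum_singleton]
  ring

theorem Atom.forall_three {P : Atom 3 → Prop} :
    (∀ A, P A) ↔ (∀ i, P (single i)) ∧ (∀ i, P (pairAvoiding i)) ∧ P triple := by
  refine ⟨fun h => ⟨fun i => h _, fun i => h _, h _⟩, fun ⟨h₁, h₂, h₃⟩ A => ?_⟩
  have hA : A ∈ (Finset.univ : Finset (Atom 3)) := Finset.mem_univ A
  rw [Atom.univ_three] at hA
  simp only [Finset.mem_insert, Finset.mem_singleton] at hA
  rcases hA with rfl | rfl | rfl | rfl | rfl | rfl | rfl <;>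
    first | exact h₁ _ | exact h₂ _ | exact h₃

theorem sum_filter_atom_three (p : Atom 3 → Prop) [DecidablePred p] (μ : Atom 3 → ℝ) :
    ∑ A with p A, μ A =
    (if p (single 0) then μ (single 0) else 0) + (if p (single 1) then μ (single 1) else 0) +
      (if p (single 2) then μ (single 2) else 0) +
      ((if p (pairAvoiding 0) then μ (pairAvoiding 0) else 0) +
        (if p (pairAvoiding 1) then μ (pairAvoiding 1) else 0) +
        (if p (pairAvoiding 2) then μ (pairAvoiding 2) else 0)) +
      (if p triple then μ triple else 0) := by
  rw [Finset.sum_filter, Atom.sum_three]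

theorem entropy_three (μ : Atom 3 → ℝ) :
    entropy μ 0 = μ (single 0) + (μ (pairAvoiding 1) + μ (pairAvoiding 2)) + μ triple ∧
    entropy μ 1 = μ (single 1) + (μ (pairAvoiding 0) + μ (pairAvoiding 2)) + μ triple ∧
    entropy μ 2 = μ (single 2) + (μ (pairAvoiding 0) + μ (pairAvoiding 1)) + μ triple := by
  simp [entropy, sum_filter_atom_three, Atom.Sub, single, pairAvoiding, triple]

theorem Finset.forall_fin_three {P : Finset (Fin 3) → Prop} :
    (∀ U, P U) ↔ P ∅ ∧ P {0} ∧ P {1} ∧ P {2} ∧ P {0, 1} ∧ P {0, 2} ∧ P {1, 2} ∧ P {0, 1, 2} := by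
  refine ⟨fun h => ⟨h _, h _, h _, h _, h _, h _, h _, h _⟩, ?_⟩
  rintro ⟨h, h0, h1, h2, h01, h02, h12, h3⟩ U
  have key : ∀ U : Finset (Fin 3), U = ∅ ∨ U = {0} ∨ U = {1} ∨ U = {2} ∨ U = {0, 1} ∨
      U = {0, 2} ∨ U = {1, 2} ∨ U = {0, 1, 2} := by decide
  rcases key U with rfl | rfl | rfl | rfl | rfl | rfl | rfl | rfl <;> assumption

theorem condEntropy_three (μ : Atom 3 → ℝ) :
    condEntropy μ ∅ = 0 ∧
    condEntropy μ {0} = μ (single 0) ∧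
    condEntropy μ {1} = μ (single 1) ∧
    condEntropy μ {2} = μ (single 2) ∧
    condEntropy μ {0, 1} = μ (single 0) + μ (single 1) + μ (pairAvoiding 2) ∧
    condEntropy μ {0, 2} = μ (single 0) + μ (single 2) + μ (pairAvoiding 1) ∧
    condEntropy μ {1, 2} = μ (single 1) + μ (single 2) + μ (pairAvoiding 0) ∧
    condEntropy μ {0, 1, 2} = ∑ A, μ A := by
  rw [Atom.sum_three]
  simp +decide [condEntropy, sum_filter_atom_three]

theorem mem_slepianWolf_three {μ : Atom 3 → ℝ} {R : Fin 3 → ℝ} :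
    R ∈ slepianWolf μ ↔
      μ (single 0) ≤ R 0 ∧ μ (single 1) ≤ R 1 ∧ μ (single 2) ≤ R 2 ∧
      μ (single 0) + μ (single 1) + μ (pairAvoiding 2) ≤ R 0 + R 1 ∧
      μ (single 0) + μ (single 2) + μ (pairAvoiding 1) ≤ R 0 + R 2 ∧
      μ (single 1) + μ (single 2) + μ (pairAvoiding 0) ≤ R 1 + R 2 ∧
      ∑ A, μ A ≤ R 0 + R 1 + R 2 := by
  obtain ⟨e, e0, e1, e2, e01, e02, e12, e3⟩ := condEntropy_three μ
  simp only [slepianWolf, Set.mem_ofPred_eq]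
  rw [Finset.forall_fin_three, e, e0, e1, e2, e01, e02, e12, e3]
  simp [add_assoc]

/-- For distinct `i`, `j` with third index `k`, the conditioning set can only be `∅` or `{k}`, and
the atoms common to `X̃ᵢ` and `X̃ⱼ` are `pairAvoiding k` and `triple`, the latter being removed by
conditioning on `k`. -/
theorem elemental_three {μ : Atom 3 → ℝ} :
    Elemental μ ↔ (∀ i, 0 ≤ μ (single i)) ∧ (∀ i, 0 ≤ μ (pairAvoiding i)) ∧
      ∀ i, 0 ≤ μ (pairAvoiding i) + μ triple := by
  obtain ⟨-, e0, e1, e2, -⟩ := condEntropy_three μ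
  have k : ∀ i j k : Fin 3, i ≠ j → i ≠ k → j ≠ k →
      condMutualInfo μ i j {k} = μ (pairAvoiding k) := by
    intro i j k
    fin_cases i <;> fin_cases j <;> fin_cases k <;>
      simp +decide [condMutualInfo, sum_filter_atom_three]
  have k' : ∀ i j k : Fin 3, i ≠ j → i ≠ k → j ≠ k →
      condMutualInfo μ i j ∅ = μ (pairAvoiding k) + μ triple := by
    intro i j k
    fin_cases i <;> fin_cases j <;> fin_cases k <;>
      simp +decide [condMutualInfo, sum_filter_atom_three]
  have others : ∀ k : Fin 3, ∃ i j, i ≠ j ∧ i ≠ k ∧ j ≠ k := by decide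
  have third : ∀ i j : Fin 3, i ≠ j → ∃ k, i ≠ k ∧ j ≠ k ∧
      ∀ K : Finset (Fin 3), i ∉ K → j ∉ K → K = ∅ ∨ K = {k} := by decide
  constructor
  · rintro ⟨h₁, h₂⟩
    refine ⟨fun i => ?_, fun i => ?_, fun i => ?_⟩
    · have := h₁ i
      fin_cases i
      · exact e0 ▸ this
      · exact e1 ▸ this
      · exact e2 ▸ this
    · obtain ⟨a, b, hab, hai, hbi⟩ := others i
      rw [← k a b i hab hai hbi]
      exact h₂ a b hab _ (by simpa using hai) (by simpa using hbi)
    · obtain ⟨a, b, hab, hai, hbi⟩ := others i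
      rw [← k' a b i hab hai hbi]
      exact h₂ a b hab _ (by simp) (by simp)
  · rintro ⟨h₁, h₂, h₃⟩
    refine ⟨fun i => ?_, fun i j hij K hi hj => ?_⟩
    · have := h₁ i
      fin_cases i
      · exact e0.symm ▸ this
      · exact e1.symm ▸ this
      · exact e2.symm ▸ this
    · obtain ⟨l, hil, hjl, hK⟩ := third i j hij
      rcases hK K hi hj with rfl | rfl
      · rw [k' i j l hij hil hjl]
        exact h₃ l
      · rw [k i j l hij hil hjl]
        exact h₂ l

/-- The measure with prescribed values on the seven atoms. -/
def atomMeasure (c a : Fin 3 → ℝ) (b : ℝ) (A : Atom 3) : ℝ :=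
  if A = triple then b else ∑ i, ((if A = single i then c i else 0) +
    if A = pairAvoiding i then a i else 0)

theorem atomMeasure_triple (c a : Fin 3 → ℝ) (b : ℝ) : atomMeasure c a b triple = b :=
  if_pos rfl

theorem atomMeasure_single (c a : Fin 3 → ℝ) (b : ℝ) (i : Fin 3) :
    atomMeasure c a b (single i) = c i := by
  fin_cases i <;> simp +decide [atomMeasure, Fin.sum_univ_three]

theorem atomMeasure_pairAvoiding (c a : Fin 3 → ℝ) (b : ℝ) (i : Fin 3) :
    atomMeasure c a b (pairAvoiding i) = a i := by
  fin_cases i <;> simp +decide [atomMeasure, Fin.sum_univ_three]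

/-- A measure satisfying the elemental inequalities is at least `-h / 2` on the triple
intersection, where `h` is its total mass. -/
theorem Elemental.neg_triple_le {μ : Atom 3 → ℝ} (hμ : Elemental μ) :
    -μ triple ≤ (∑ A, μ A) / 2 := by
  obtain ⟨h₁, h₂, h₃⟩ := elemental_three.1 hμ
  rw [Atom.sum_three]
  have := h₁ 0; have := h₁ 1; have := h₁ 2
  have := h₃ 0; have := h₃ 1; have := h₃ 2
  -- The total is `∑ c i + ∑ (a i + b) - 2 * b`, whose two sums are nonnegative.
  linarith

/-- Boundedness for the compactness argument; the constant `2` is not sharp. -/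
theorem Elemental.abs_le {μ : Atom 3 → ℝ} (hμ : Elemental μ) (A : Atom 3) :
    |μ A| ≤ 2 * ∑ A, μ A := by
  obtain ⟨h₁, h₂, h₃⟩ := elemental_three.1 hμ
  revert A
  have ht := hμ.neg_triple_le
  rw [Atom.sum_three] at ht ⊢
  have := h₁ 0; have := h₁ 1; have := h₁ 2
  have := h₂ 0; have := h₂ 1; have := h₂ 2
  have := h₃ 0; have := h₃ 1; have := h₃ 2
  rw [Atom.forall_three]
  refine ⟨fun i => ?_, fun i => ?_, ?_⟩
  · fin_cases i <;> simp only [Fin.mk_zero, Fin.mk_one, Fin.reduceFinMk] <;> rw [_root_.abs_le] <;>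
      constructor <;> linarith
  · fin_cases i <;> simp only [Fin.mk_zero, Fin.mk_one, Fin.reduceFinMk] <;> rw [_root_.abs_le] <;>
      constructor <;> linarith
  · rw [_root_.abs_le]
    constructor <;> linarith

theorem Elemental.of_nonneg {μ : Atom 3 → ℝ} (hμ : ∀ A, 0 ≤ μ A) : Elemental μ :=
  elemental_three.2 ⟨fun _ => hμ _, fun _ => hμ _, fun _ => add_nonneg (hμ _) (hμ _)⟩

theorem Elemental.nonneg {μ : Atom 3 → ℝ} (hμ : Elemental μ) (hb : 0 ≤ μ triple) (A : Atom 3) :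
    0 ≤ μ A := by
  obtain ⟨h₁, h₂, -⟩ := elemental_three.1 hμ
  exact (Atom.forall_three (P := fun A => 0 ≤ μ A)).2 ⟨h₁, h₂, hb⟩ A

theorem isClosed_elemental (n : ℕ) : IsClosed {μ : Atom n → ℝ | Elemental μ} := by
  have e : {μ : Atom n → ℝ | Elemental μ} = (⋂ i, {μ | 0 ≤ condEntropy μ {i}}) ∩
      ⋂ i, ⋂ j, ⋂ (_ : i ≠ j), ⋂ K : Finset (Fin n), ⋂ (_ : i ∉ K), ⋂ (_ : j ∉ K),
        {μ | 0 ≤ condMutualInfo μ i j K} := by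
    ext μ
    simp [Elemental]
  rw [e]
  refine (isClosed_iInter fun i => isClosed_le continuous_const ?_).inter
    (isClosed_iInter fun i => isClosed_iInter fun j => isClosed_iInter fun _ =>
      isClosed_iInter fun K => isClosed_iInter fun _ => isClosed_iInter fun _ =>
        isClosed_le continuous_const ?_)
  · unfold condEntropy
    fun_prop
  · unfold condMutualInfo
    fun_prop

end AtomMeasure

set_option linter.unusedSectionVars false

/-! ### Flows on the augmented graph and their virtual edges. -/

namespace Network

variable {V : Type*} [Fintype V] [DecidableEq V] {n : ℕ} (N : Network V n)

theorem mem_augEdges_virtual (i : Fin n) : (none, some (N.src i)) ∈ N.augEdges := by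
  simp [augEdges]

theorem mem_augEdges_some {u v : V} : (some u, some v) ∈ N.augEdges ↔ (u, v) ∈ N.edges := by
  simp [augEdges]

theorem mem_augEdges_none {v : Option V} :
    (none, v) ∈ N.augEdges ↔ ∃ i, v = some (N.src i) := by
  simp [augEdges, eq_comm]

theorem not_mem_augEdges_to_none {u : Option V} : (u, none) ∉ N.augEdges := by
  simp [augEdges]

theorem sum_virtual_edges (g : Option V → ℝ) :
    ∑ w with (none, w) ∈ N.augEdges, g w = ∑ i, g (some (N.src i)) := by
  have e : (Finset.univ.filter fun w => (none, w) ∈ N.augEdges) =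
      Finset.univ.image fun i => some (N.src i) := by
    ext w
    simp [mem_augEdges_none, eq_comm]
  rw [e, Finset.sum_image]
  intro i _ j _ hij
  exact N.src.injective (Option.some_injective _ hij)

variable {N}

theorem FlowFeasible.sum_virtual {p : FlowVars V} (hp : N.FlowFeasible p) {t : V}
    (ht : t ∈ N.terminals) : ∑ i, p.x t none (some (N.src i)) = N.h := by
  have := hp.2 t ht none
  rw [N.sum_virtual_edges fun w => p.x t none w] at this
  simpa [not_mem_augEdges_to_none, sigma] using this

theorem FlowFeasible.virtual_nonneg {p : FlowVars V} (hp : N.FlowFeasible p) {t : V}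
    (ht : t ∈ N.terminals) (i : Fin n) : 0 ≤ p.x t none (some (N.src i)) :=
  (hp.1 t ht _ _ (N.mem_augEdges_virtual i)).1

theorem FlowFeasible.virtual_le {p : FlowVars V} (hp : N.FlowFeasible p) {t : V}
    (ht : t ∈ N.terminals) (i : Fin n) :
    p.x t none (some (N.src i)) ≤ p.z none (some (N.src i)) :=
  (hp.1 t ht _ _ (N.mem_augEdges_virtual i)).2.1

theorem FlowFeasible.virtual_le_h {p : FlowVars V} (hp : N.FlowFeasible p) {t : V}
    (ht : t ∈ N.terminals) (i : Fin n) : p.x t none (some (N.src i)) ≤ N.h := by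
  rw [← hp.sum_virtual ht]
  exact Finset.single_le_sum (f := fun i => p.x t none (some (N.src i)))
    (fun j _ => hp.virtual_nonneg ht j) (Finset.mem_univ i)

variable (N)

/-- The flow variables `p` with the amounts `z` on the virtual edges replaced by `g`. -/
noncomputable def withVirtual (p : FlowVars V) (g : Fin n → ℝ) : FlowVars V where
  x := p.x
  z
    -- The default `0` is harmless: at nodes that are not sources there is no virtual edge.
    | none, some v => Function.extend N.src g 0 v
    | u, v => p.z u v

@[simp]
theorem withVirtual_z_src (p : FlowVars V) (g : Fin n → ℝ) (i : Fin n) :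
    (N.withVirtual p g).z none (some (N.src i)) = g i :=
  N.src.injective.extend_apply g 0 i

variable {N}

theorem FlowFeasible.withVirtual {p : FlowVars V} (hp : N.FlowFeasible p) {g : Fin n → ℝ}
    (hg : ∀ t ∈ N.terminals, ∀ i, p.x t none (some (N.src i)) ≤ g i) :
    N.FlowFeasible (N.withVirtual p g) := by
  refine ⟨fun t ht u v huv => ?_, hp.2⟩
  have := hp.1 t ht u v huv
  cases u with
  | none =>
    obtain ⟨i, rfl⟩ := N.mem_augEdges_none.1 huv
    refine ⟨this.1, ?_, le_top⟩
    rw [withVirtual_z_src]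
    exact hg t ht i
  | some u => exact this

/-- Double counting of the pairs of a source and an atom inside it; this identifies the two
objectives. -/
theorem sum_mul_entropy (d : Fin n → ℝ) (μ : Atom n → ℝ) :
    ∑ i, d i * entropy μ i = ∑ A : Atom n, (∑ i with A.Sub {i}, d i) * μ A := by
  simp only [entropy, Finset.mul_sum, Finset.sum_mul, Finset.sum_filter]
  rw [Finset.sum_comm]
  refine Finset.sum_congr rfl fun A _ => Finset.sum_congr rfl fun i _ => ?_
  split_ifs <;> simp

theorem AtomFeasible.subsetCost_eq {p : AtomVars V n} (hp : N.AtomFeasible p) :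
    N.subsetCost p = N.codedCost p.toFlowVars := by
  simp only [subsetCost, codedCost, hp.2.2.2.1, sum_mul_entropy]

/-! ### Existence of minimizers by compactness. -/

section Attainment

variable (N)

/-- The variables of the atom problems with given flow and atom measures and with the rates
equal to the flows on the virtual edges. -/
def ofFlowMeasure (p : (V → Option V → Option V → ℝ) × (Option V → Option V → ℝ) × (Atom n → ℝ)) :
    AtomVars V n where
  x := p.1
  z := p.2.1
  R t i := p.1 t none (some (N.src i))
  μ := p.2.2

theorem continuous_codedCost :
    Continuous fun p => N.codedCost (N.ofFlowMeasure p).toFlowVars := by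
  unfold codedCost edgeCost ofFlowMeasure
  fun_prop

theorem isClosed_slepianWolf {X : Type*} [TopologicalSpace X] {R : X → Fin n → ℝ}
    {μ : X → Atom n → ℝ} (hR : Continuous R) (hμ : Continuous μ) :
    IsClosed {p | R p ∈ slepianWolf (μ p)} := by
  have e : {p | R p ∈ slepianWolf (μ p)} =
      ⋂ U : Finset (Fin n), {p | condEntropy (μ p) U ≤ ∑ i ∈ U, R p i} := by
    ext p
    simp [slepianWolf]
  rw [e]
  refine isClosed_iInter fun U => isClosed_le ?_ ?_
  · unfold condEntropy
    fun_prop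
  · fun_prop

theorem isClosed_atomFeasible : IsClosed {p | N.AtomFeasible (N.ofFlowMeasure p)} := by
  simp only [AtomFeasible, FlowFeasible, ofFlowMeasure, le_refl, implies_true, true_and,
    Set.ofPred_and, Set.ofPred_forall]
  refine (IsClosed.inter ?_ ?_).inter (IsClosed.inter ?_ (IsClosed.inter ?_ ?_))
  · refine isClosed_iInter fun t => isClosed_iInter fun _ => isClosed_iInter fun u =>
      isClosed_iInter fun v => isClosed_iInter fun _ => ?_
    refine (isClosed_le ?_ ?_).inter ((isClosed_le ?_ ?_).inter (isClosed_le ?_ ?_))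
    · fun_prop
    · fun_prop
    · fun_prop
    · fun_prop
    · exact continuous_coe_real_ereal.comp (by fun_prop)
    · fun_prop
  · refine isClosed_iInter fun t => isClosed_iInter fun _ => isClosed_iInter fun u =>
      isClosed_eq ?_ ?_ <;> fun_prop
  · exact isClosed_iInter fun t => isClosed_iInter fun _ =>
      isClosed_slepianWolf (by fun_prop) (by fun_prop)
  · refine isClosed_iInter fun t => isClosed_eq ?_ ?_
    · fun_prop
    · unfold entropy
      fun_prop
  · refine isClosed_eq ?_ ?_ <;> fun_prop

/-- The part of atom variables that matters: flows at terminals and edges, and measures. -/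
def significantPart (p : AtomVars V n) :
    (V → Option V → Option V → ℝ) × (Option V → Option V → ℝ) × (Atom n → ℝ) :=
  (fun t u v => if t ∈ N.terminals ∧ (u, v) ∈ N.augEdges then p.x t u v else 0,
    fun u v => if (u, v) ∈ N.augEdges then p.z u v else 0, p.μ)

theorem codedCost_significantPart (p : AtomVars V n) :
    N.codedCost (N.ofFlowMeasure (N.significantPart p)).toFlowVars =
      N.codedCost p.toFlowVars := by
  unfold codedCost edgeCost
  congr 1
  · refine Finset.sum_congr rfl fun e he => ?_
    simp [ofFlowMeasure, significantPart, mem_augEdges_some, he]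
  · simp [ofFlowMeasure, significantPart, mem_augEdges_virtual]

variable {N}

/-- Raising the rates to the flows on the virtual edges is allowed, since the Slepian–Wolf region is
closed upwards. This eliminates the rates, which are not bounded below individually by the other
variables alone. -/
theorem AtomFeasible.significantPart {p : AtomVars V n} (hp : N.AtomFeasible p) :
    N.AtomFeasible (N.ofFlowMeasure (N.significantPart p)) := by
  obtain ⟨⟨h₁, h₂⟩, h₃, h₄, h₅, h₆⟩ := hp
  refine ⟨⟨fun t ht u v huv => ?_, fun t ht v => ?_⟩, fun t ht i => le_rfl, fun t ht U => ?_,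
    fun i => ?_, h₆⟩
  · simpa [ofFlowMeasure, Network.significantPart, ht, huv] using h₁ t ht u v huv
  · rw [← h₂ t ht v]
    congr 1 <;> refine Finset.sum_congr rfl fun w hw => ?_ <;>
      simp [ofFlowMeasure, Network.significantPart, ht, (Finset.mem_filter.1 hw).2]
  · refine (h₄ t ht U).trans (Finset.sum_le_sum fun i _ => (h₃ t ht i).trans_eq ?_)
    simp [ofFlowMeasure, Network.significantPart, ht, mem_augEdges_virtual]
  · simpa [ofFlowMeasure, Network.significantPart, mem_augEdges_virtual] using h₅ i

/-- Capacities bound `z` on the edges of `G`; virtual edges have infinite capacity, but there `z` is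
an entropy, bounded through the measure. The irrelevant coordinates have been set to `0`. -/
theorem AtomFeasible.exists_bound (N : Network V n) (B : ℝ) : ∃ M : ℝ, ∀ p : AtomVars V n,
    N.AtomFeasible p → (∀ A, |p.μ A| ≤ B) →
      N.significantPart p ∈ Set.Icc (fun _ _ _ => -M, fun _ _ => -M, fun _ => -M)
        (fun _ _ _ => M, fun _ _ => M, fun _ => M) := by
  set C := ∑ e ∈ N.edges, |N.cap e.1 e.2| with hC
  set D := ∑ _A : Atom n, |B| with hD
  have hC0 : 0 ≤ C := Finset.sum_nonneg fun _ _ => abs_nonneg _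
  have hD0 : 0 ≤ D := Finset.sum_nonneg fun _ _ => abs_nonneg _
  have hM0 : 0 ≤ C + D + |B| := by positivity
  refine ⟨C + D + |B|, fun p hp hB => ?_⟩
  obtain ⟨t₀, ht₀⟩ := N.terminals_nonempty
  have hz : ∀ u v, (u, v) ∈ N.augEdges → p.z u v ≤ C + D + |B| := by
    intro u v huv
    cases u with
    | none =>
      obtain ⟨i, rfl⟩ := N.mem_augEdges_none.1 huv
      rw [hp.2.2.2.1 i]
      have : entropy p.μ i ≤ D := by
        unfold entropy
        rw [Finset.sum_filter]
        refine Finset.sum_le_sum fun A _ => ?_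
        split_ifs
        · exact (le_abs_self _).trans ((hB A).trans (le_abs_self _))
        · exact abs_nonneg _
      linarith [abs_nonneg B]
    | some u =>
      cases v with
      | none => exact absurd huv N.not_mem_augEdges_to_none
      | some v =>
        have h₁ : p.z (some u) (some v) ≤ N.cap u v :=
          EReal.coe_le_coe_iff.1 (hp.1.1 t₀ ht₀ _ _ huv).2.2
        have h₂ : |N.cap u v| ≤ C :=
          Finset.single_le_sum (f := fun e : V × V => |N.cap e.1 e.2|)
            (fun _ _ => abs_nonneg _) (N.mem_augEdges_some.1 huv)
        linarith [abs_nonneg B, le_abs_self (N.cap u v)]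
  have hx : ∀ t u v, |(N.significantPart p).1 t u v| ≤ C + D + |B| := by
    intro t u v
    simp only [Network.significantPart]
    split_ifs with h
    · have := hp.1.1 t h.1 u v h.2
      rw [abs_of_nonneg this.1]
      exact this.2.1.trans (hz u v h.2)
    · simpa using hM0
  have hz' : ∀ u v, |(N.significantPart p).2.1 u v| ≤ C + D + |B| := by
    intro u v
    simp only [Network.significantPart]
    split_ifs with h
    · have := hp.1.1 t₀ ht₀ u v h
      rw [abs_of_nonneg (this.1.trans this.2.1)]
      exact hz u v h
    · simpa using hM0
  have hμ : ∀ A, |(N.significantPart p).2.2 A| ≤ C + D + |B| := by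
    intro A
    exact (hB A).trans ((le_abs_self B).trans (by linarith))
  exact ⟨⟨fun t u v => (abs_le.1 (hx t u v)).1, fun u v => (abs_le.1 (hz' u v)).1,
      fun A => (abs_le.1 (hμ A)).1⟩,
    ⟨fun t u v => (abs_le.1 (hx t u v)).2, fun u v => (abs_le.1 (hz' u v)).2,
      fun A => (abs_le.1 (hμ A)).2⟩⟩

/-- The coded cost attains its minimum over the atom variables with measures in a closed set in
which the measures of total mass `h` are bounded. -/
theorem AtomFeasible.exists_min_codedCost {P : Set (Atom n → ℝ)} (hP : IsClosed P) {B : ℝ}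
    (hB : ∀ μ ∈ P, N.h = ∑ A, μ A → ∀ A, |μ A| ≤ B) (hne : ∃ p, N.AtomFeasible p ∧ p.μ ∈ P) :
    ∃ p, (N.AtomFeasible p ∧ p.μ ∈ P) ∧
      ∀ q, N.AtomFeasible q → q.μ ∈ P → N.codedCost p.toFlowVars ≤ N.codedCost q.toFlowVars := by
  obtain ⟨M, hM⟩ := AtomFeasible.exists_bound N B
  set K := ({p | N.AtomFeasible (N.ofFlowMeasure p)} ∩ {p | p.2.2 ∈ P}) ∩
    Set.Icc (fun _ _ _ => -M, fun _ _ => -M, fun _ => -M)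
      (fun _ _ _ => M, fun _ _ => M, fun _ => M) with hK
  have hcl : IsClosed ({p | N.AtomFeasible (N.ofFlowMeasure p)} ∩ {p | p.2.2 ∈ P}) :=
    N.isClosed_atomFeasible.inter (hP.preimage (continuous_snd.comp continuous_snd))
  have hcomp : IsCompact K := isCompact_Icc.inter_left hcl
  have hmem : ∀ q, N.AtomFeasible q → q.μ ∈ P → N.significantPart q ∈ K := fun q hq hqP =>
    ⟨⟨hq.significantPart, hqP⟩, hM q hq (hB _ hqP hq.2.2.2.2)⟩
  obtain ⟨q₀, hq₀, hq₀P⟩ := hne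
  obtain ⟨p, hpK, hp⟩ := hcomp.exists_isMinOn ⟨_, hmem q₀ hq₀ hq₀P⟩
    N.continuous_codedCost.continuousOn
  refine ⟨N.ofFlowMeasure p, hpK.1, fun q hq hqP => ?_⟩
  rw [← N.codedCost_significantPart q]
  exact hp (hmem q hq hqP)

end Attainment

end Network

/-! ### Comparison of the three problems for three sources. -/

namespace Network

variable {V : Type*} [Fintype V] [DecidableEq V] {N : Network V 3}

open Atom

/-- Every feasible flow is at least as costly as one that comes with atom measures satisfying the
elemental inequalities: reduce the storage to at most `h` and take the measures for which
`H(X_W) = min h (∑_{i ∈ W} zᵢ)`. -/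
theorem FlowFeasible.exists_atomCodedFeasible {p : FlowVars V} (hp : N.FlowFeasible p) :
    ∃ q, N.AtomCodedFeasible q ∧ N.codedCost q.toFlowVars ≤ N.codedCost p := by
  set g : Fin 3 → ℝ := fun i => min (p.z none (some (N.src i))) N.h with hg
  have hxg : ∀ t ∈ N.terminals, ∀ i, p.x t none (some (N.src i)) ≤ g i := fun t ht i =>
    le_min (hp.virtual_le ht i) (hp.virtual_le_h ht i)
  have hgh : ∀ i, g i ≤ N.h := fun i => min_le_right _ _
  obtain ⟨t₀, ht₀⟩ := N.terminals_nonempty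
  have hg0 : ∀ i, 0 ≤ g i := fun i => (hp.virtual_nonneg ht₀ i).trans (hxg t₀ ht₀ i)
  have hsum : N.h ≤ g 0 + g 1 + g 2 := by
    rw [← hp.sum_virtual ht₀, Fin.sum_univ_three]
    linarith [hxg t₀ ht₀ 0, hxg t₀ ht₀ 1, hxg t₀ ht₀ 2]
  -- `J i j` plays the joint entropy of two sources. It is kept opaque so that `linarith` only sees
  -- the bounds below.
  obtain ⟨J, hJ⟩ : ∃ J : Fin 3 → Fin 3 → ℝ, ∀ i j, J i j = min N.h (g i + g j) :=
    ⟨_, fun _ _ => rfl⟩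
  have hJh : ∀ i j, J i j ≤ N.h := fun i j => hJ i j ▸ min_le_left _ _
  have hJg : ∀ i j, J i j ≤ g i + g j := fun i j => hJ i j ▸ min_le_right _ _
  -- Submodularity, which yields nonnegativity of the `pairAvoiding` atoms.
  have hJJ : ∀ i j k, N.h ≤ g i + g j + g k → N.h + g k ≤ J i k + J j k := by
    intro i j k h
    rw [hJ i k, hJ j k]
    rcases min_choice N.h (g i + g k) with e | e <;>
      rcases min_choice N.h (g j + g k) with e' | e' <;>
      rw [e, e'] <;> linarith [hgh k, hg0 i, hg0 j]
  -- Möbius inversion of the entropies `g i`, `J i j` and `N.h`.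
  set μ : Atom 3 → ℝ := atomMeasure ![N.h - J 1 2, N.h - J 0 2, N.h - J 0 1]
    ![J 1 0 + J 2 0 - g 0 - N.h, J 0 1 + J 2 1 - g 1 - N.h, J 0 2 + J 1 2 - g 2 - N.h]
    (g 0 + g 1 + g 2 - J 0 1 - J 0 2 - J 1 2 + N.h) with hμ
  have e0 : μ (single 0) = N.h - J 1 2 := atomMeasure_single _ _ _ _
  have e1 : μ (single 1) = N.h - J 0 2 := atomMeasure_single _ _ _ _
  have e2 : μ (single 2) = N.h - J 0 1 := atomMeasure_single _ _ _ _
  have a0 : μ (pairAvoiding 0) = J 1 0 + J 2 0 - g 0 - N.h := atomMeasure_pairAvoiding _ _ _ _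
  have a1 : μ (pairAvoiding 1) = J 0 1 + J 2 1 - g 1 - N.h := atomMeasure_pairAvoiding _ _ _ _
  have a2 : μ (pairAvoiding 2) = J 0 2 + J 1 2 - g 2 - N.h := atomMeasure_pairAvoiding _ _ _ _
  have eb : μ triple = g 0 + g 1 + g 2 - J 0 1 - J 0 2 - J 1 2 + N.h := atomMeasure_triple _ _ _
  have s10 : J 1 0 = J 0 1 := by rw [hJ, hJ, add_comm]
  have s20 : J 2 0 = J 0 2 := by rw [hJ, hJ, add_comm]
  have s21 : J 2 1 = J 1 2 := by rw [hJ, hJ, add_comm]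
  have htot : ∑ A, μ A = N.h := by
    rw [Atom.sum_three]
    linarith
  refine ⟨{ toFlowVars := N.withVirtual p g, R := fun t i => p.x t none (some (N.src i)), μ := μ },
    ⟨⟨hp.withVirtual hxg, fun t ht i => le_rfl, fun t ht => ?_, fun i => ?_, htot.symm⟩, ?_⟩, ?_⟩
  · have := hp.sum_virtual ht
    rw [Fin.sum_univ_three] at this
    have hx := hxg t ht
    have hx0 := hp.virtual_nonneg ht
    -- Two rates sum to at most the joint entropy; subtracting from the total `h` gives the
    -- Slepian–Wolf bound for the third source.
    have hxJ : ∀ i j k, p.x t none (some (N.src i)) + p.x t none (some (N.src j)) +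
        p.x t none (some (N.src k)) = N.h →
        p.x t none (some (N.src i)) + p.x t none (some (N.src j)) ≤ J i j := by
      intro i j k h
      rw [hJ]
      exact le_min (by linarith [hx0 k]) (add_le_add (hx i) (hx j))
    have h01 := hxJ 0 1 2 (by linarith)
    have h02 := hxJ 0 2 1 (by linarith)
    have h12 := hxJ 1 2 0 (by linarith)
    rw [mem_slepianWolf_three]
    refine ⟨?_, ?_, ?_, ?_, ?_, ?_, ?_⟩ <;> linarith [hx 0, hx 1, hx 2]
  · rw [withVirtual_z_src]
    obtain ⟨h0, h1, h2⟩ := entropy_three μ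
    fin_cases i <;> simp only [Fin.mk_zero, Fin.mk_one, Fin.reduceFinMk] <;> linarith
  · refine elemental_three.2 ⟨fun i => ?_, fun i => ?_, fun i => ?_⟩
    · fin_cases i <;> simp only [Fin.mk_zero, Fin.mk_one, Fin.reduceFinMk]
      · linarith [hJh 1 2]
      · linarith [hJh 0 2]
      · linarith [hJh 0 1]
    · fin_cases i <;> simp only [Fin.mk_zero, Fin.mk_one, Fin.reduceFinMk]
      · linarith [hJJ 1 2 0 (by linarith)]
      · linarith [hJJ 0 2 1 (by linarith)]
      · linarith [hJJ 0 1 2 (by linarith)]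
    · fin_cases i <;> simp only [Fin.mk_zero, Fin.mk_one, Fin.reduceFinMk]
      · linarith [hJg 1 2]
      · linarith [hJg 0 2]
      · linarith [hJg 0 1]
  · change N.edgeCost p + _ ≤ N.edgeCost p + _
    refine add_le_add le_rfl (Finset.sum_le_sum fun i _ => ?_)
    rw [withVirtual_z_src]
    exact mul_le_mul_of_nonneg_left (min_le_left _ _) (N.d_nonneg i)

/-- From measures with negative mass on the triple intersection, nonnegative measures arise by
storing `|b|` more at a single source. -/
theorem AtomCodedFeasible.exists_subsetFeasible {p : AtomVars V 3} (hp : N.AtomCodedFeasible p)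
    (hb : p.μ triple < 0) (k : Fin 3) :
    ∃ q, N.SubsetFeasible q ∧
      N.codedCost q.toFlowVars = N.codedCost p.toFlowVars + N.d k * |p.μ triple| := by
  obtain ⟨⟨hflow, hR, hSW, hz, hh⟩, hel⟩ := hp
  obtain ⟨h₁, h₂, h₃⟩ := elemental_three.1 hel
  set b := p.μ triple with hbdef
  -- Removing `b` from the triple atom raises every entropy by `|b|`; adding `b` to `pairAvoiding k`
  -- undoes this for the two sources other than `k`. The total is unchanged and the other
  -- conditional entropies do not increase, so the old rates still work.
  set μ : Atom 3 → ℝ := atomMeasure (fun i => p.μ (single i))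
    (fun i => p.μ (pairAvoiding i) + if i = k then b else 0) 0 with hμ
  have ec : ∀ i, μ (single i) = p.μ (single i) := fun i => atomMeasure_single _ _ _ _
  have ea : ∀ i, μ (pairAvoiding i) = p.μ (pairAvoiding i) + if i = k then b else 0 :=
    fun i => atomMeasure_pairAvoiding _ _ _ _
  have eb : μ triple = 0 := atomMeasure_triple _ _ _
  set g : Fin 3 → ℝ := fun i => p.z none (some (N.src i)) + if i = k then |b| else 0 with hg
  have hxg : ∀ t ∈ N.terminals, ∀ i, p.x t none (some (N.src i)) ≤ g i := by
    intro t ht i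
    refine (hflow.virtual_le ht i).trans ?_
    simp only [hg]
    split_ifs <;> linarith [abs_nonneg b]
  have htot : ∑ A, μ A = ∑ A, p.μ A := by
    rw [Atom.sum_three, Atom.sum_three]
    simp only [ec, ea, eb]
    fin_cases k <;> simp <;> ring
  have hdec : ∀ i, μ (pairAvoiding i) ≤ p.μ (pairAvoiding i) := by
    intro i
    rw [ea]
    split_ifs <;> linarith
  refine ⟨{ toFlowVars := N.withVirtual p.toFlowVars g, R := p.R, μ := μ },
    ⟨⟨hflow.withVirtual hxg, hR, fun t ht => ?_, fun i => ?_, hh.trans htot.symm⟩, ?_⟩, ?_⟩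
  · have := mem_slepianWolf_three.1 (hSW t ht)
    rw [mem_slepianWolf_three]
    simp only [htot, ec]
    obtain ⟨w0, w1, w2, w01, w02, w12, w⟩ := this
    exact ⟨w0, w1, w2, by linarith [hdec 2], by linarith [hdec 1], by linarith [hdec 0], w⟩
  · rw [withVirtual_z_src]
    simp only [hg, hz, abs_of_neg hb]
    obtain ⟨h0, h1, h2⟩ := entropy_three μ
    obtain ⟨h0', h1', h2'⟩ := entropy_three p.μ
    simp only [ec, ea, eb] at h0 h1 h2
    fin_cases i <;> simp only [Fin.mk_zero, Fin.mk_one, Fin.reduceFinMk] <;>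
      simp only [h0, h1, h2, h0', h1', h2'] <;> fin_cases k <;> simp <;> ring
  · refine (Atom.forall_three (P := fun A => 0 ≤ μ A)).2 ⟨fun i => ?_, fun i => ?_, ?_⟩
    · rw [ec]
      exact h₁ i
    · rw [ea]
      split_ifs
      · exact h₃ i
      · simpa using h₂ i
    · rw [eb]
  · change N.edgeCost p.toFlowVars + _ = N.edgeCost p.toFlowVars + _ + _
    simp only [withVirtual_z_src, hg, mul_add, Finset.sum_add_distrib, add_assoc]
    simp

theorem FlowFeasible.exists_subsetFeasible {p : FlowVars V} (hp : N.FlowFeasible p) :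
    ∃ q, N.SubsetFeasible q := by
  obtain ⟨q, hq, -⟩ := hp.exists_atomCodedFeasible
  rcases le_or_gt 0 (q.μ triple) with h | h
  · exact ⟨q, hq.1, hq.2.nonneg h⟩
  · obtain ⟨r, hr, -⟩ := hq.exists_subsetFeasible h 0
    exact ⟨r, hr⟩

theorem exists_atomCodedOptimal (hN : ∃ p, N.FlowFeasible p) : ∃ p, N.AtomCodedOptimal p := by
  obtain ⟨p₀, hp₀⟩ := hN
  obtain ⟨q, hq, -⟩ := hp₀.exists_atomCodedFeasible
  obtain ⟨p, hp, hmin⟩ := AtomFeasible.exists_min_codedCost (N := N) (isClosed_elemental 3)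
    (B := 2 * N.h) (fun μ hμ hh A => hh ▸ Elemental.abs_le hμ A) ⟨q, hq⟩
  exact ⟨p, hp, fun q hq => hmin q hq.1 hq.2⟩

theorem AtomCodedOptimal.isCodedMinCost {p : AtomVars V 3} (hp : N.AtomCodedOptimal p) :
    N.IsCodedMinCost (N.codedCost p.toFlowVars) := by
  refine ⟨⟨_, hp.1.1.1, rfl⟩, ?_⟩
  rintro _ ⟨q, hq, rfl⟩
  obtain ⟨r, hr, hrq⟩ := FlowFeasible.exists_atomCodedFeasible hq
  exact (hp.2 r hr).trans hrq

theorem exists_isSubsetMinCost (hN : ∃ p, N.FlowFeasible p) : ∃ c, N.IsSubsetMinCost c := by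
  obtain ⟨p₀, hp₀⟩ := hN
  have hcl : IsClosed {μ : Atom 3 → ℝ | ∀ A, 0 ≤ μ A} := by
    simp only [Set.ofPred_forall]
    exact isClosed_iInter fun A => isClosed_le continuous_const (continuous_apply A)
  obtain ⟨p, hp, hmin⟩ := AtomFeasible.exists_min_codedCost (N := N) hcl
    (B := 2 * N.h) (fun μ hμ hh A => hh ▸ (Elemental.of_nonneg hμ).abs_le A)
    hp₀.exists_subsetFeasible
  refine ⟨N.subsetCost p, ⟨p, hp, rfl⟩, ?_⟩
  rintro _ ⟨q, hq, rfl⟩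
  rw [hp.1.subsetCost_eq, hq.1.subsetCost_eq]
  exact hmin q hq.1 hq.2

theorem exists_minD_eq (N : Network V 3) : ∃ k, N.minD = N.d k := by
  obtain ⟨k, -, hk⟩ := Finset.exists_mem_eq_inf' Finset.univ_nonempty N.d
  exact ⟨k, hk⟩

theorem subset_sub_coded_bounds (hN : ∃ p, N.FlowFeasible p) :
    ∃ fsubset fcoded : ℝ,
      N.IsSubsetMinCost fsubset ∧ N.IsCodedMinCost fcoded ∧
      (∃ p, N.AtomCodedOptimal p) ∧
      ∀ p, N.AtomCodedOptimal p →
        N.codedCost p.toFlowVars = fcoded ∧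
        (0 ≤ p.μ triple → fsubset = fcoded) ∧
        (p.μ triple < 0 →
          fsubset - fcoded ≤ N.minD * |p.μ triple| ∧
          N.minD * |p.μ triple| ≤ N.minD * (N.h / 2)) := by
  obtain ⟨fsubset, hs⟩ := exists_isSubsetMinCost hN
  obtain ⟨p₀, hp₀⟩ := exists_atomCodedOptimal hN
  refine ⟨fsubset, _, hs, hp₀.isCodedMinCost, ⟨p₀, hp₀⟩, fun p hp => ?_⟩
  have heq : N.codedCost p.toFlowVars = N.codedCost p₀.toFlowVars :=
    hp.isCodedMinCost.unique hp₀.isCodedMinCost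
  refine ⟨heq, fun hb => le_antisymm ?_ ?_, fun hb => ⟨?_, ?_⟩⟩
  · rw [← heq, ← hp.1.1.subsetCost_eq]
    exact hs.2 ⟨p, ⟨hp.1.1, hp.1.2.nonneg hb⟩, rfl⟩
  · obtain ⟨q, hq, rfl⟩ := hs.1
    rw [hq.1.subsetCost_eq]
    exact hp₀.2 q ⟨hq.1, Elemental.of_nonneg hq.2⟩
  · obtain ⟨k, hk⟩ := N.exists_minD_eq
    obtain ⟨q, hq, hcost⟩ := hp.1.exists_subsetFeasible hb k
    have := hs.2 ⟨q, hq, rfl⟩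
    rw [hq.1.subsetCost_eq, hcost] at this
    rw [hk]
    linarith
  · obtain ⟨k, hk⟩ := N.exists_minD_eq
    refine mul_le_mul_of_nonneg_left ?_ (hk ▸ N.d_nonneg k)
    rw [abs_of_neg hb, hp.1.1.2.2.2.2]
    exact hp.1.2.neg_triple_le

end Network

/-! ### The nine-node network attaining the bound. -/

section Example

open Atom

/-- A network in which every edge is saturated by every feasible flow: the two source nodes `0`
and `1` feed the terminals `5` (through the relays `3` and `4`) and `8`, the source nodes `0` and
`2` feed the terminal `6`, and the source nodes `1` and `2` feed the terminal `7`. -/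
noncomputable def saturatedNetwork : Network (Fin 9) 3 where
  edges := {(0, 3), (1, 3), (3, 5), (3, 4), (4, 5), (0, 6), (2, 6), (1, 7), (2, 7), (0, 8), (1, 8)}
  cap _ _ := 1
  f _ _ := 1
  src := ⟨![0, 1, 2], by decide⟩
  terminals := {5, 6, 7, 8}
  terminals_nonempty := ⟨5, by decide⟩
  d := ![2, 2, 1]
  d_nonneg i := by fin_cases i <;> simp
  h := 2
  h_nonneg := by norm_num

namespace saturatedNetwork

theorem minD_eq : saturatedNetwork.minD = 1 := by
  refine le_antisymm (Finset.inf'_le (b := 2) saturatedNetwork.d (Finset.mem_univ _)) ?_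
  refine Finset.le_inf' _ _ fun i _ => ?_
  fin_cases i <;> norm_num [saturatedNetwork]

theorem codedCost_eq (p : FlowVars (Fin 9)) :
    saturatedNetwork.codedCost p = saturatedNetwork.edgeCost p +
      (2 * p.z none (some 0) + 2 * p.z none (some 1) + p.z none (some 2)) := by
  rw [Network.codedCost, Fin.sum_univ_three]
  simp [saturatedNetwork]

/-- Taking the neighbourhoods as explicit sets lets `decide` verify them at each vertex. -/
theorem balance {p : FlowVars (Fin 9)} (hp : saturatedNetwork.FlowFeasible p) {t : Fin 9}
    (ht : t ∈ saturatedNetwork.terminals) (v : Option (Fin 9)) (out inn : Finset (Option (Fin 9)))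
    (hout : (Finset.univ.filter fun w => (v, w) ∈ saturatedNetwork.augEdges) = out)
    (hinn : (Finset.univ.filter fun w => (w, v) ∈ saturatedNetwork.augEdges) = inn) :
    ∑ w ∈ out, p.x t v w - ∑ w ∈ inn, p.x t w v = saturatedNetwork.sigma t v := by
  rw [← hout, ← hinn]
  exact hp.2 t ht v

theorem balances {p : FlowVars (Fin 9)} (hp : saturatedNetwork.FlowFeasible p) {t : Fin 9}
    (ht : t ∈ saturatedNetwork.terminals) :
    (p.x t none (some 0) + p.x t none (some 1) + p.x t none (some 2) = 2) ∧
    (p.x t (some 0) (some 3) + p.x t (some 0) (some 6) + p.x t (some 0) (some 8) =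
      p.x t none (some 0)) ∧
    (p.x t (some 1) (some 3) + p.x t (some 1) (some 7) + p.x t (some 1) (some 8) =
      p.x t none (some 1)) ∧
    (p.x t (some 2) (some 6) + p.x t (some 2) (some 7) = p.x t none (some 2)) ∧
    (p.x t (some 3) (some 5) + p.x t (some 3) (some 4) =
      p.x t (some 0) (some 3) + p.x t (some 1) (some 3)) ∧
    (p.x t (some 4) (some 5) = p.x t (some 3) (some 4)) ∧
    (p.x t (some 3) (some 5) + p.x t (some 4) (some 5) = if t = 5 then 2 else 0) ∧
    (p.x t (some 0) (some 6) + p.x t (some 2) (some 6) = if t = 6 then 2 else 0) ∧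
    (p.x t (some 1) (some 7) + p.x t (some 2) (some 7) = if t = 7 then 2 else 0) ∧
    (p.x t (some 0) (some 8) + p.x t (some 1) (some 8) = if t = 8 then 2 else 0) := by
  have hs := balance hp ht none {some 0, some 1, some 2} ∅ (by decide) (by decide)
  have h0 := balance hp ht (some 0) {some 3, some 6, some 8} {none} (by decide) (by decide)
  have h1 := balance hp ht (some 1) {some 3, some 7, some 8} {none} (by decide) (by decide)
  have h2 := balance hp ht (some 2) {some 6, some 7} {none} (by decide) (by decide)
  have h3 := balance hp ht (some 3) {some 5, some 4} {some 0, some 1} (by decide) (by decide)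
  have h4 := balance hp ht (some 4) {some 5} {some 3} (by decide) (by decide)
  have h5 := balance hp ht (some 5) ∅ {some 3, some 4} (by decide) (by decide)
  have h6 := balance hp ht (some 6) ∅ {some 0, some 2} (by decide) (by decide)
  have h7 := balance hp ht (some 7) ∅ {some 1, some 2} (by decide) (by decide)
  have h8 := balance hp ht (some 8) ∅ {some 0, some 1} (by decide) (by decide)
  have ht' : t = 5 ∨ t = 6 ∨ t = 7 ∨ t = 8 := by simpa [saturatedNetwork] using ht
  rcases ht' with rfl | rfl | rfl | rfl <;>
    simp [Network.sigma, saturatedNetwork] at hs h0 h1 h2 h3 h4 h5 h6 h7 h8 <;>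
    refine ⟨?_, ?_, ?_, ?_, ?_, ?_, ?_, ?_, ?_, ?_⟩ <;>
    first | linarith | (simp; linarith)

theorem edge_bounds {p : FlowVars (Fin 9)} (hp : saturatedNetwork.FlowFeasible p) {t : Fin 9}
    (ht : t ∈ saturatedNetwork.terminals) {u v : Fin 9} (huv : (u, v) ∈ saturatedNetwork.edges) :
    0 ≤ p.x t (some u) (some v) ∧ p.x t (some u) (some v) ≤ p.z (some u) (some v) ∧
      p.z (some u) (some v) ≤ 1 := by
  obtain ⟨h₁, h₂, h₃⟩ := hp.1 t ht _ _ (saturatedNetwork.mem_augEdges_some.2 huv)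
  exact ⟨h₁, h₂, EReal.coe_le_coe_iff.1 h₃⟩

/-- Each terminal must receive two units over two unit edges, so both are full; for terminal `5`
this propagates back through the relays to `(0, 3)` and `(1, 3)`. Flow cannot end at other
terminals, so the rates are forced as well. -/
theorem rates {p : FlowVars (Fin 9)} (hp : saturatedNetwork.FlowFeasible p) :
    saturatedNetwork.edgeCost p = 11 ∧
    (p.x 5 none (some 0) = 1 ∧ p.x 5 none (some 1) = 1 ∧ p.x 5 none (some 2) = 0) ∧
    (p.x 6 none (some 0) = 1 ∧ p.x 6 none (some 1) = 0 ∧ p.x 6 none (some 2) = 1) ∧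
    (p.x 7 none (some 0) = 0 ∧ p.x 7 none (some 1) = 1 ∧ p.x 7 none (some 2) = 1) := by
  have nonneg : ∀ t ∈ saturatedNetwork.terminals, ∀ e ∈ saturatedNetwork.edges,
      0 ≤ p.x t (some e.1) (some e.2) := fun t ht e he => (edge_bounds hp ht he).1
  have le_z : ∀ t ∈ saturatedNetwork.terminals, ∀ e ∈ saturatedNetwork.edges,
      p.x t (some e.1) (some e.2) ≤ p.z (some e.1) (some e.2) :=
    fun t ht e he => (edge_bounds hp ht he).2.1
  have z_le : ∀ e ∈ saturatedNetwork.edges, p.z (some e.1) (some e.2) ≤ 1 :=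
    fun e he => (edge_bounds hp (t := 5) (by decide) he).2.2
  have m5 : (5 : Fin 9) ∈ saturatedNetwork.terminals := by decide
  have m6 : (6 : Fin 9) ∈ saturatedNetwork.terminals := by decide
  have m7 : (7 : Fin 9) ∈ saturatedNetwork.terminals := by decide
  have m8 : (8 : Fin 9) ∈ saturatedNetwork.terminals := by decide
  have b5 := balances hp m5
  have b6 := balances hp m6
  have b7 := balances hp m7
  have b8 := balances hp m8
  have n5 := nonneg 5 m5
  have n6 := nonneg 6 m6
  have n7 := nonneg 7 m7
  have n8 := nonneg 8 m8
  have l5 := le_z 5 m5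
  have l6 := le_z 6 m6
  have l7 := le_z 7 m7
  have l8 := le_z 8 m8
  simp [saturatedNetwork] at b5 b6 b7 b8 n5 n6 n7 n8 l5 l6 l7 l8 z_le
  have hcost : saturatedNetwork.edgeCost p = p.z (some 0) (some 3) + p.z (some 1) (some 3) +
      p.z (some 3) (some 5) + p.z (some 3) (some 4) + p.z (some 4) (some 5) +
      p.z (some 0) (some 6) + p.z (some 2) (some 6) + p.z (some 1) (some 7) +
      p.z (some 2) (some 7) + p.z (some 0) (some 8) + p.z (some 1) (some 8) := by
    simp [Network.edgeCost, saturatedNetwork, add_assoc]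
  have r5 : p.x 5 none (some 0) = 1 ∧ p.x 5 none (some 1) = 1 ∧ p.x 5 none (some 2) = 0 := by
    refine ⟨?_, ?_, ?_⟩ <;> linarith
  have r6 : p.x 6 none (some 0) = 1 ∧ p.x 6 none (some 1) = 0 ∧ p.x 6 none (some 2) = 1 := by
    refine ⟨?_, ?_, ?_⟩ <;> linarith
  have r7 : p.x 7 none (some 0) = 0 ∧ p.x 7 none (some 1) = 1 ∧ p.x 7 none (some 2) = 1 := by
    refine ⟨?_, ?_, ?_⟩ <;> linarith
  refine ⟨?_, r5, r6, r7⟩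
  rw [hcost]
  -- The eleven edges split as `5 + 2 + 2 + 2` among the four terminals, and each lower bound needs
  -- the facts of one terminal only; clearing the rest keeps `linarith` small.
  clear hcost nonneg le_z hp r5 r6 r7
  refine le_antisymm (by clear b5 b6 b7 b8 n5 n6 n7 n8 l5 l6 l7 l8; linarith) ?_
  have : 5 ≤ p.z (some 0) (some 3) + p.z (some 1) (some 3) +
      p.z (some 3) (some 5) + p.z (some 3) (some 4) + p.z (some 4) (some 5) := by
    clear b6 b7 b8 n6 n7 n8 l6 l7 l8
    linarith
  have : 2 ≤ p.z (some 0) (some 6) + p.z (some 2) (some 6) := by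
    clear b5 b7 b8 n5 n7 n8 l5 l7 l8
    linarith
  have : 2 ≤ p.z (some 1) (some 7) + p.z (some 2) (some 7) := by
    clear b5 b6 b8 n5 n6 n8 l5 l6 l8
    linarith
  have : 2 ≤ p.z (some 0) (some 8) + p.z (some 1) (some 8) := by
    clear b5 b6 b7 n5 n6 n7 l5 l6 l7
    linarith
  clear b5 b6 b7 b8 n5 n6 n7 n8 l5 l6 l7 l8
  linarith

theorem one_le_storage {p : FlowVars (Fin 9)} (hp : saturatedNetwork.FlowFeasible p) :
    1 ≤ p.z none (some 0) ∧ 1 ≤ p.z none (some 1) ∧ 1 ≤ p.z none (some 2) := by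
  obtain ⟨-, ⟨h0, h1, -⟩, ⟨-, -, h2⟩, -⟩ := rates hp
  have m5 : (5 : Fin 9) ∈ saturatedNetwork.terminals := by decide
  have m6 : (6 : Fin 9) ∈ saturatedNetwork.terminals := by decide
  exact ⟨h0 ▸ hp.virtual_le m5 0, h1 ▸ hp.virtual_le m5 1, h2 ▸ hp.virtual_le m6 2⟩

/-- The edges used by the flow to a terminal. -/
def pathEdges (t : Fin 9) : Finset (Option (Fin 9) × Option (Fin 9)) :=
  if t = 5 then {(none, some 0), (none, some 1), (some 0, some 3), (some 1, some 3),
    (some 3, some 5), (some 3, some 4), (some 4, some 5)}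
  else if t = 6 then {(none, some 0), (none, some 2), (some 0, some 6), (some 2, some 6)}
  else if t = 7 then {(none, some 1), (none, some 2), (some 1, some 7), (some 2, some 7)}
  else {(none, some 0), (none, some 1), (some 0, some 8), (some 1, some 8)}

/-- The feasible flow that stores one unit at each source. -/
def unitFlow : FlowVars (Fin 9) where
  x t u v := if (u, v) ∈ pathEdges t then 1 else 0
  z _ _ := 1

/-- Flow conservation for the 0-1 flow, rearranged without subtraction into natural numbers so that
it is decidable. -/
theorem pathEdges_balance : ∀ t ∈ saturatedNetwork.terminals, ∀ v : Option (Fin 9),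
    (Finset.univ.filter fun w => (v, w) ∈ saturatedNetwork.augEdges ∧ (v, w) ∈ pathEdges t).card +
      (if v = some t then 2 else 0) =
    (Finset.univ.filter fun w => (w, v) ∈ saturatedNetwork.augEdges ∧ (w, v) ∈ pathEdges t).card +
      if v = none then 2 else 0 := by
  decide

theorem flowFeasible_unitFlow : saturatedNetwork.FlowFeasible unitFlow := by
  refine ⟨fun t ht u v huv => ⟨?_, ?_, ?_⟩, fun t ht v => ?_⟩
  · simp only [unitFlow]
    split_ifs <;> norm_num
  · simp only [unitFlow]
    split_ifs <;> norm_num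
  · cases u with
    | none => exact le_top
    | some u =>
      cases v with
      | none => exact le_top
      | some v => exact le_rfl
  · have h := congrArg (Nat.cast : ℕ → ℝ) (pathEdges_balance t ht v)
    push_cast at h
    simp only [unitFlow, Finset.sum_boole, Finset.filter_filter, Network.sigma]
    have h2 : saturatedNetwork.h = 2 := rfl
    rw [h2]
    cases v with
    | none =>
      simp only [reduceCtorEq, if_false, if_true] at h ⊢
      linarith
    | some v =>
      simp only [reduceCtorEq, if_false] at h ⊢
      split_ifs at h ⊢ <;> linarith

theorem codedCost_unitFlow : saturatedNetwork.codedCost unitFlow = 16 := by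
  rw [codedCost_eq, (rates flowFeasible_unitFlow).1]
  norm_num [unitFlow]

theorem isCodedMinCost : saturatedNetwork.IsCodedMinCost 16 := by
  refine ⟨⟨_, flowFeasible_unitFlow, codedCost_unitFlow⟩, ?_⟩
  rintro _ ⟨p, hp, rfl⟩
  rw [codedCost_eq, (rates hp).1]
  linarith [one_le_storage hp]

/-- Each source sends nothing to one of the terminals `5`, `6`, `7`, and the Slepian–Wolf bound for
that source alone applies there. -/
theorem single_nonpos {p : AtomVars (Fin 9) 3} (hp : saturatedNetwork.AtomFeasible p) :
    p.μ (single 0) ≤ 0 ∧ p.μ (single 1) ≤ 0 ∧ p.μ (single 2) ≤ 0 := by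
  obtain ⟨-, ⟨-, -, h2⟩, ⟨-, h1, -⟩, ⟨h0, -, -⟩⟩ := rates hp.1
  have m5 : (5 : Fin 9) ∈ saturatedNetwork.terminals := by decide
  have m6 : (6 : Fin 9) ∈ saturatedNetwork.terminals := by decide
  have m7 : (7 : Fin 9) ∈ saturatedNetwork.terminals := by decide
  have r7 : p.R 7 0 ≤ p.x 7 none (some 0) := hp.2.1 7 m7 0
  have r6 : p.R 6 1 ≤ p.x 6 none (some 1) := hp.2.1 6 m6 1
  have r5 : p.R 5 2 ≤ p.x 5 none (some 2) := hp.2.1 5 m5 2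
  have s7 := (mem_slepianWolf_three.1 (hp.2.2.1 7 m7)).1
  have s6 := (mem_slepianWolf_three.1 (hp.2.2.1 6 m6)).2.1
  have s5 := (mem_slepianWolf_three.1 (hp.2.2.1 5 m5)).2.2.1
  refine ⟨?_, ?_, ?_⟩ <;> linarith

theorem storage_eq {p : AtomVars (Fin 9) 3} (hp : saturatedNetwork.AtomFeasible p) :
    p.z none (some 0) = entropy p.μ 0 ∧ p.z none (some 1) = entropy p.μ 1 ∧
      p.z none (some 2) = entropy p.μ 2 :=
  ⟨hp.2.2.2.1 0, hp.2.2.2.1 1, hp.2.2.2.1 2⟩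

/-- Cost `16` forces unit storage at each source. With `c i = 0` this gives `2 * ∑ a i + 3 * b = 3`,
and the total mass gives `∑ a i + b = 2`. -/
theorem triple_eq_of_optimal {p : AtomVars (Fin 9) 3} (hp : saturatedNetwork.AtomCodedOptimal p) :
    p.μ triple = -1 := by
  have hcost := hp.isCodedMinCost.unique isCodedMinCost
  have hfeas := hp.1.1
  rw [codedCost_eq, (rates hfeas.1).1] at hcost
  obtain ⟨z0, z1, z2⟩ := one_le_storage hfeas.1
  obtain ⟨c0, c1, c2⟩ := single_nonpos hfeas
  obtain ⟨e0, e1, e2⟩ := storage_eq hfeas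
  obtain ⟨h0, h1, h2⟩ := entropy_three p.μ
  have k0 := (elemental_three.1 hp.1.2).1 0
  have k1 := (elemental_three.1 hp.1.2).1 1
  have k2 := (elemental_three.1 hp.1.2).1 2
  have hh : 2 = ∑ A, p.μ A := hfeas.2.2.2.2
  rw [Atom.sum_three] at hh
  linarith

/-- With all `c i = 0`, every remaining atom lies in at least two sources and so costs at least `1 +
2 = 3` per unit; mass `2` costs at least `6` on top of the edge cost `11`. -/
theorem seventeen_le_subsetCost {p : AtomVars (Fin 9) 3}
    (hp : saturatedNetwork.SubsetFeasible p) : 17 ≤ saturatedNetwork.subsetCost p := by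
  have hfeas := hp.1
  rw [hfeas.subsetCost_eq, codedCost_eq, (rates hfeas.1).1]
  obtain ⟨c0, c1, c2⟩ := single_nonpos hfeas
  obtain ⟨e0, e1, e2⟩ := storage_eq hfeas
  obtain ⟨h0, h1, h2⟩ := entropy_three p.μ
  have hh : 2 = ∑ A, p.μ A := hfeas.2.2.2.2
  rw [Atom.sum_three] at hh
  linarith [hp.2 (single 0), hp.2 (single 1), hp.2 (single 2), hp.2 (pairAvoiding 0),
    hp.2 (pairAvoiding 1), hp.2 (pairAvoiding 2), hp.2 triple]

theorem isSubsetMinCost : saturatedNetwork.IsSubsetMinCost 17 := by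
  obtain ⟨p, hp⟩ := Network.exists_atomCodedOptimal ⟨_, flowFeasible_unitFlow⟩
  have hb := triple_eq_of_optimal hp
  -- Index `2` is the source of least storage cost, so the repair costs exactly `1`.
  obtain ⟨q, hq, hcost⟩ := hp.1.exists_subsetFeasible (by rw [hb]; norm_num) 2
  refine ⟨⟨q, hq, ?_⟩, ?_⟩
  · have hd : saturatedNetwork.d 2 = 1 := rfl
    rw [hq.1.subsetCost_eq, hcost, hp.isCodedMinCost.unique isCodedMinCost, hb, hd]
    norm_num
  · rintro _ ⟨r, hr, rfl⟩
    exact seventeen_le_subsetCost hr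

end saturatedNetwork

end Example

theorem mainTheorem1 :
    (∀ (V : Type*) [Fintype V] [DecidableEq V] (N : Network V 3),
      (∃ p, N.FlowFeasible p) →
      ∃ fsubset fcoded : ℝ,
        N.IsSubsetMinCost fsubset ∧ N.IsCodedMinCost fcoded ∧
        (∃ p, N.AtomCodedOptimal p) ∧
        ∀ p, N.AtomCodedOptimal p →
          N.codedCost p.toFlowVars = fcoded ∧
          (0 ≤ p.μ Atom.triple → fsubset = fcoded) ∧
          (p.μ Atom.triple < 0 →
            fsubset - fcoded ≤ N.minD * |p.μ Atom.triple| ∧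
            N.minD * |p.μ Atom.triple| ≤ N.minD * (N.h / 2))) ∧
    (∃ N : Network (Fin 9) 3,
      (∀ e ∈ N.edges, N.cap e.1 e.2 = 1 ∧ N.f e.1 e.2 = 1) ∧
      (N.src : Fin 3 → Fin 9) = ![0, 1, 2] ∧ N.terminals = {5, 6, 7, 8} ∧
      N.d = ![2, 2, 1] ∧ N.h = 2 ∧
      N.IsSubsetMinCost 17 ∧ N.IsCodedMinCost 16 ∧
      (∃ p, N.AtomCodedOptimal p) ∧
      ∀ p, N.AtomCodedOptimal p →
        p.μ Atom.triple < 0 ∧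
        (17 : ℝ) - 16 = N.minD * |p.μ Atom.triple| ∧
        N.minD * |p.μ Atom.triple| = N.minD * (N.h / 2)) := by
  refine ⟨fun V _ _ N hN => Network.subset_sub_coded_bounds hN, saturatedNetwork,
    fun _ _ => ⟨rfl, rfl⟩, rfl, rfl, rfl, rfl, saturatedNetwork.isSubsetMinCost,
    saturatedNetwork.isCodedMinCost,
    Network.exists_atomCodedOptimal ⟨_, saturatedNetwork.flowFeasible_unitFlow⟩, fun p hp => ?_⟩
  have hh : saturatedNetwork.h = 2 := rfl
  rw [saturatedNetwork.triple_eq_of_optimal hp, saturatedNetwork.minD_eq, hh]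
  norm_num
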